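/- Fix $c\in\mathbb{R}$. For $1\le p<\infty$ let $X^p_c$ be the space of functions $f:\mathbb{R}^+\to\mathbb{C}$ with $u\mapsto u^{c-1/p}f(u)\in L^p(\mathbb{R}^+)$, and put $\|f\|_{X^\infty_c}=\sup_{x>0}|x^cf(x)|$. For $f\in X^2_c$ the Mellin transform $v\mapsto[f]^\wedge_{M_c}(c+iv)$ is the limit in $L^2(\mathbb{R})$, as $\rho\to\infty$, of $v\mapsto\int_{1/\rho}^{\rho}f(u)u^{c+iv-1}\,du$. Let $\mathcal{M}^2_c$ be the space of continuous $f\in X^2_c$ whose Mellin transform is integrable over the line $\{c\}\times i\mathbb{R}$, and, for $\sigma>0$, let $B^2_{c,\sigma}$ be the space of continuous $f\in X^2_c$ with $[f]^\wedge_{M_c}(c+iv)=0$ for (almost) all $|v|>\sigma$. Let $G^1_c$ be the space of functions of the form $f(x)=\frac1{2\pi}\int_{\mathbb{R}}\varphi(v)x^{-c-iv}\,dv$ $(x>0)$ with $\varphi\in L^1(\mathbb{R})$; here $\varphi$ is unique up to a null set, and $[\!|f|\!]_1:=\|\varphi\|_{L^1(\mathbb{R})}$. For $f\in G^1_c$ put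 $\operatorname{dist}_1(f,B^2_{c,\sigma})=\inf_{g\in B^2_{c,\sigma}}[\!|f-g|\!]_1$. The Mellin derivative is $\Theta_cf(x)=\lim_{h\to1}\frac{h^cf(hx)-f(x)}{h-1}$. **Theorem.** Let $f\in\mathcal{M}^2_c$ and suppose that $v\mapsto v\,[f]^\wedge_{M_c}(c+iv)$ is absolutely integrable on $\mathbb{R}$. Then, for every $T>0$ and $x>0$, the Mellin derivative $\Theta_cf(x)$ exists, the following series converges absolutely, and, defining $(R^B_{\pi T}f)(x)$ by $$\Theta_cf(x)=\frac{4T}{\pi}\sum_{k\in\mathbb{Z}}\frac{(-1)^{k+1}}{(2k-1)^2}\,e^{(k-1/2)c/T}f\bigl(xe^{(k-1/2)/T}\bigr)+(R^B_{\pi T}f)(x),$$ one has $$(R^B_{\pi T}f)(x)=\frac1{2\pi i}\int_{|v|\ge\pi T}\Bigl[v-\pi T\,\phi\Bigl(\frac v{\pi T}\Bigr)\Bigr][f]^\wedge_{M_c}(c+iv)\,x^{-c-iv}\,dv,\qquad \phi(v):=\Bigl|v+1-4\Bigl\lfloor\frac{v+3}4\Bigr\rfloor\Bigr|-1,$$ both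 this integral and the next one being absolutely convergent. In particular, $$|(R^B_{\pi T}f)(x)|\le\frac{x^{-c}}{2\pi}\int_{|v|\ge\pi T}(|v|+\pi T)\,\bigl|[f]^\wedge_{M_c}(c+iv)\bigr|\,dv .$$ Moreover $\Theta_cf\in G^1_c$, the distance $\operatorname{dist}_1(\Theta_cf,B^2_{c,\pi T})$ is finite, and $$\|R^B_{\pi T}f\|_{X^\infty_c}\le\frac1\pi\operatorname{dist}_1\bigl(\Theta_cf,B^2_{c,\pi T}\bigr).$$ -/

import Mathlib

open MeasureTheory Filter Topology
open scoped ENNReal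

noncomputable section

namespace MellinBoas

/-! Functions on `ℝ⁺` are represented by functions on `ℝ` of which only the values at `x > 0` matter,
functions on the line `{c} × iℝ` by functions of the ordinate `v : ℝ`. -/

/-- `f ∈ X²_c`, that is, `u ↦ u ^ (c - 1/2) f(u)` belongs to `L²(ℝ⁺)`. -/
def MemX2 (c : ℝ) (f : ℝ → ℂ) : Prop :=
  MemLp (fun u : ℝ => ((u ^ (c - 1 / 2) : ℝ) : ℂ) * f u) 2 (volume.restrict (Set.Ioi 0))

/-- The norm of `X^∞_c`: `sup_{x > 0} |x ^ c f(x)|`, with values in `[0, ∞]`. -/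
def normXInfty (c : ℝ) (f : ℝ → ℂ) : ℝ≥0∞ :=
  ⨆ x : Set.Ioi (0 : ℝ), ‖(((x : ℝ) ^ c : ℝ) : ℂ) * f x‖ₑ

/-- The truncated Mellin integral `∫_{1/ρ}^ρ f(u) u ^ (c + it - 1) du`. -/
def truncatedMellin (c : ℝ) (f : ℝ → ℂ) (ρ t : ℝ) : ℂ :=
  ∫ u in (1 / ρ)..ρ, f u * (u : ℂ) ^ ((c : ℂ) + Complex.I * (t : ℂ) - 1)

/-- `g ∈ L²(ℝ)` is the limit in `L²`-mean of the truncated Mellin integrals of `f`, as `ρ → ∞`. -/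
def IsMellinTransform (c : ℝ) (f g : ℝ → ℂ) : Prop :=
  MemLp g 2 volume ∧
    Tendsto (fun ρ : ℝ => eLpNorm (fun t => g t - truncatedMellin c f ρ t) 2 volume) atTop (𝓝 0)

/-- The Mellin transform `v ↦ [f]^∧(c + iv)` of `f ∈ X²_c`: a function that is the limit in
`L²`-mean of the truncated Mellin integrals. It is determined up to a null set. -/
def mellinTransform (c : ℝ) (f : ℝ → ℂ) : ℝ → ℂ :=
  Classical.epsilon (IsMellinTransform c f)

/-- The Mellin inversion class `M²_c`: continuous `f ∈ X²_c` with integrable Mellin transform. -/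
def MemM2 (c : ℝ) (f : ℝ → ℂ) : Prop :=
  MemX2 c f ∧ ContinuousOn f (Set.Ioi 0) ∧ Integrable (mellinTransform c f)

/-- The Mellin–Bernstein space `B²_{c,σ}`: continuous `f ∈ X²_c` whose Mellin transform vanishes
outside `[-σ, σ]`. -/
def MemB2 (c σ : ℝ) (f : ℝ → ℂ) : Prop :=
  MemX2 c f ∧ ContinuousOn f (Set.Ioi 0) ∧ ∀ᵐ v : ℝ, σ < |v| → mellinTransform c f v = 0

/-- `φ ∈ L¹ ∩ L^q` represents `f`: `f(x) = (1/2π) ∫ φ(v) x ^ (-c - iv) dv` for all `x > 0`. -/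
def Represents (q : ℝ≥0∞) (c : ℝ) (f φ : ℝ → ℂ) : Prop :=
  Integrable φ ∧ MemLp φ q volume ∧
    ∀ x : ℝ, 0 < x → f x = 1 / (2 * (Real.pi : ℂ)) *
      ∫ v : ℝ, φ v * (x : ℂ) ^ (-(c : ℂ) - Complex.I * (v : ℂ))

/-- The space `G^q_c`. -/
def MemG (q : ℝ≥0∞) (c : ℝ) (f : ℝ → ℂ) : Prop :=
  ∃ φ : ℝ → ℂ, Represents q c f φ

/-- The norm of `G^q_c`: the `L^q` norm of the function `φ` that represents `f` (`φ` is unique up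
to a null set, so the infimum is over a single value); it is `∞` outside `G^q_c`. -/
def normG (q : ℝ≥0∞) (c : ℝ) (f : ℝ → ℂ) : ℝ≥0∞ :=
  ⨅ (φ : ℝ → ℂ) (_ : Represents q c f φ), eLpNorm φ q volume

/-- `dist_q(f, B²_{c,σ})`. -/
def distB2 (q : ℝ≥0∞) (c σ : ℝ) (f : ℝ → ℂ) : ℝ≥0∞ :=
  ⨅ (g : ℝ → ℂ) (_ : MemB2 c σ g), normG q c (f - g)

/-- The difference quotient `(h ^ c f(hx) - f(x)) / (h - 1)`. -/
def mellinQuotient (c : ℝ) (f : ℝ → ℂ) (x h : ℝ) : ℂ :=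
  (((h ^ c : ℝ) : ℂ) * f (h * x) - f x) / ((h : ℂ) - 1)

/-- The Mellin derivative of `f` at `x` exists and equals `d`. -/
def HasMellinDeriv (c : ℝ) (f : ℝ → ℂ) (x : ℝ) (d : ℂ) : Prop :=
  Tendsto (mellinQuotient c f x) (𝓝[≠] 1) (𝓝 d)

/-- The first Mellin derivative `Θ_c f`. -/
def mellinDeriv (c : ℝ) (f : ℝ → ℂ) (x : ℝ) : ℂ :=
  limUnder (𝓝[≠] (1 : ℝ)) (mellinQuotient c f x)

/-- The `k`-th term `(-1)^{k+1} / (2k-1)² · e^{(k-1/2)c/T} f(x e^{(k-1/2)/T})`. -/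
def boasTerm (c T : ℝ) (f : ℝ → ℂ) (x : ℝ) (k : ℤ) : ℂ :=
  (((-1 : ℝ) ^ (k + 1) / (2 * (k : ℝ) - 1) ^ 2 *
      Real.exp (((k : ℝ) - 1 / 2) * c / T) : ℝ) : ℂ) *
    f (x * Real.exp (((k : ℝ) - 1 / 2) / T))

/-- The remainder `R^B_{πT} f` of the Mellin–Boas formula: the deviation of the series from
`Θ_c f`. -/
def boasRemainder (c T : ℝ) (f : ℝ → ℂ) (x : ℝ) : ℂ :=
  mellinDeriv c f x - ((4 * T / Real.pi : ℝ) : ℂ) * ∑' k : ℤ, boasTerm c T f x k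

/-- The triangle wave `φ(v) = |v + 1 - 4⌊(v + 3)/4⌋| - 1`. -/
def triangleWave (v : ℝ) : ℝ :=
  |v + 1 - 4 * (⌊(v + 3) / 4⌋ : ℝ)| - 1

/-- The integrand `[v - πT φ(v/(πT))] [f]^∧(c + iv) x ^ (-c - iv)`. -/
def remainderIntegrand (c T : ℝ) (f : ℝ → ℂ) (x v : ℝ) : ℂ :=
  ((v - Real.pi * T * triangleWave (v / (Real.pi * T)) : ℝ) : ℂ) *
    mellinTransform c f v * (x : ℂ) ^ (-(c : ℂ) - Complex.I * (v : ℂ))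

end MellinBoas

end

open MellinBoas

/-! With `f(x) = x^{-c} F(-log x)` the theorem becomes Fourier analysis on `ℝ`: `f` is represented
by `φ` exactly if `F` is the inverse Fourier transform of `w ↦ φ(2πw)`. Then `Θ_c` multiplies the
representing function by `-iv`. The Boas series adds up shifts of `F` by half-integer multiples of
`1/T`, so it multiplies `φ` by a trigonometric series, whose coefficients are up to a constant the
Fourier coefficients of the triangle wave: `4T/π` times the series multiplies `φ` by `-iπT` times
the triangle wave at `v/(πT)`. This factor agrees with `-iv` for `|v| ≤ πT`, hence the remainder is
represented by a function that vanishes there and is at most `2|vφ(v)|` elsewhere. Subtracting an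
element of `B²_{c,πT}` from `Θ_c f` does not change the representing function on `|v| > πT`, whence
the bound by the distance. -/

namespace MellinBoas

section Fourier

open FourierTransform SchwartzMap

variable {V F : Type*} [NormedAddCommGroup V] [InnerProductSpace ℝ V] [FiniteDimensional ℝ V]
  [MeasurableSpace V] [BorelSpace V] [NormedAddCommGroup F] [NormedSpace ℂ F]

theorem continuous_fourier_of_integrable {f : V → F} (hf : Integrable f) : Continuous (𝓕 f) :=
  VectorFourier.fourierIntegral_continuous Real.continuous_fourierChar (L := innerₗ V)
    continuous_inner hf

theorem continuous_fourierInv_of_integrable {f : V → F} (hf : Integrable f) :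
    Continuous (𝓕⁻ f) :=
  VectorFourier.fourierIntegral_continuous Real.continuous_fourierChar (L := -innerₗ V)
    continuous_inner.neg hf

theorem hasDerivAt_fourierInv {f : ℝ → F} (hf : Integrable f)
    (hf' : Integrable fun w : ℝ => w • f w) (t : ℝ) :
    HasDerivAt (𝓕⁻ f) (𝓕⁻ (fun w : ℝ => (2 * Real.pi * Complex.I * w) • f w) t) t := by
  have hneg : Integrable fun w : ℝ => w • f (-w) := by
    simpa using hf'.comp_neg.neg
  have h := Real.hasDerivAt_fourier hf.comp_neg hneg t
  simpa only [Real.fourierInv_eq_fourier_comp_neg, Complex.ofReal_neg, mul_neg, neg_mul] using h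

theorem hasSum_smul_fourierInv_sub {ι : Type*} [Countable ι] {a : ι → ℂ} (ha : Summable a)
    {s : ι → V} {m : V → ℂ}
    (hm : ∀ w, HasSum (fun i => a i * Real.fourierChar (-inner ℝ w (s i))) (m w))
    {f : V → F} (hf : Integrable f) (t : V) :
    HasSum (fun i => a i • 𝓕⁻ f (t - s i)) (𝓕⁻ (fun w => m w • f w) t) := by
  set G : ι → V → F := fun i w => a i • Real.fourierChar (inner ℝ w (t - s i)) • f w with hG
  have hinteg : ∀ i, Integrable (G i) := fun i => by
    refine Integrable.smul (a i) ?_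
    simpa [← inner_neg_right] using (Real.fourierIntegral_convergent_iff (s i - t)).2 hf
  have hnorm : Summable fun i => ∫ w, ‖G i w‖ := by
    simp only [hG, norm_smul, Circle.norm_smul, integral_const_mul]
    exact ha.norm.mul_right _
  have hsum : ∀ w, HasSum (fun i => G i w) (Real.fourierChar (inner ℝ w t) • m w • f w) := by
    intro w
    convert! (hm w).smul_const (Real.fourierChar (inner ℝ w t) • f w) using 1
    · ext i
      simp only [hG]
      rw [inner_sub_right, sub_eq_neg_add, AddChar.map_add_eq_mul, mul_smul, mul_smul,
        Circle.smul_def (Real.fourierChar (-inner ℝ w (s i)))]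
    · exact smul_comm _ _ _
  have hexchange := hasSum_integral_of_summable_integral_norm hinteg hnorm
  simp only [fun w => (hsum w).tsum_eq] at hexchange
  simpa only [hG, integral_smul, Real.fourierInv_eq] using hexchange

variable [CompleteSpace F]

theorem ae_eq_of_forall_integral_schwartz_smul_eq {f g : V → F} (hf : LocallyIntegrable f)
    (hg : LocallyIntegrable g) (h : ∀ ψ : 𝓢(V, ℂ), ∫ x, ψ x • f x = ∫ x, ψ x • g x) :
    f =ᵐ[volume] g := by
  refine ae_eq_of_integral_contDiff_smul_eq hf hg fun θ θ_smooth θ_compact => ?_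
  have hc : HasCompactSupport (Complex.ofRealCLM ∘ θ) := θ_compact.comp_left rfl
  have hs : ContDiff ℝ (⊤ : ℕ∞) (Complex.ofRealCLM ∘ θ) := by fun_prop
  simpa using h (hc.toSchwartzMap hs)

theorem integral_schwartz_fourier_smul {f : V → F} (hf : Integrable f) (ψ : 𝓢(V, ℂ)) :
    ∫ x, (𝓕 ψ) x • f x = ∫ x, ψ x • 𝓕 f x := by
  rw [SchwartzMap.fourier_coe]
  simpa only [flip_innerₗ] using!
    VectorFourier.integral_fourierIntegral_smul_eq_flip (L := innerₗ V)
      Real.continuous_fourierChar continuous_inner (ψ.integrable (μ := volume)) hf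

theorem integral_schwartz_fourierInv_smul {f : V → F} (hf : Integrable f) (ψ : 𝓢(V, ℂ)) :
    ∫ x, (𝓕⁻ ψ) x • f x = ∫ x, ψ x • 𝓕⁻ f x := by
  have hflip : (-innerₗ V).flip = -innerₗ V := by
    ext x y; simp [real_inner_comm]
  rw [SchwartzMap.fourierInv_coe]
  simpa only [hflip] using!
    VectorFourier.integral_fourierIntegral_smul_eq_flip (L := -innerₗ V)
      Real.continuous_fourierChar continuous_inner.neg (ψ.integrable (μ := volume)) hf

theorem ae_eq_of_fourierInv_eq {f g : V → F} (hf : Integrable f) (hg : Integrable g)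
    (h : 𝓕⁻ f = 𝓕⁻ g) : f =ᵐ[volume] g := by
  refine ae_eq_of_forall_integral_schwartz_smul_eq hf.locallyIntegrable hg.locallyIntegrable
    fun ψ => ?_
  have hψ : 𝓕⁻ (𝓕 ψ) = ψ := fourierInv_fourier_eq ψ
  rw [← hψ, integral_schwartz_fourierInv_smul hf,
    integral_schwartz_fourierInv_smul hg, h]

end Fourier

section L2Fourier

open FourierTransform SchwartzMap

variable {V F : Type*} [NormedAddCommGroup V] [InnerProductSpace ℝ V] [FiniteDimensional ℝ V]
  [MeasurableSpace V] [BorelSpace V] [NormedAddCommGroup F] [InnerProductSpace ℂ F]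
  [CompleteSpace F] {f g : V → F}

theorem integral_schwartz_fourier_smul_of_memLp (hf : MemLp f 2) (ψ : 𝓢(V, ℂ)) :
    ∫ x, (𝓕 ψ) x • f x = ∫ x, ψ x • (𝓕 hf.toLp : Lp F 2 (volume : Measure V)) x := by
  have h := DFunLike.congr_fun (Lp.fourier_toTemperedDistribution_eq hf.toLp) ψ
  rw [TemperedDistribution.fourier_apply, Lp.toTemperedDistribution_apply,
    Lp.toTemperedDistribution_apply] at h
  rw [← h]
  refine integral_congr_ae ?_
  filter_upwards [hf.coeFn_toLp] with x hx
  rw [hx]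

theorem coeFn_fourier_toLp (h₁ : Integrable f) (h₂ : MemLp f 2) :
    (𝓕 h₂.toLp : Lp F 2 (volume : Measure V)) =ᵐ[volume] 𝓕 f := by
  refine ae_eq_of_forall_integral_schwartz_smul_eq ((Lp.memLp _).locallyIntegrable one_le_two)
    (continuous_fourier_of_integrable h₁).locallyIntegrable fun ψ => ?_
  rw [← integral_schwartz_fourier_smul_of_memLp, integral_schwartz_fourier_smul h₁]

theorem eq_fourierInv_fourier_toLp (hc : Continuous f) (h₂ : MemLp f 2)
    (hi : Integrable (𝓕 h₂.toLp : Lp F 2 (volume : Measure V))) :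
    f = 𝓕⁻ ((𝓕 h₂.toLp : Lp F 2 (volume : Measure V)) : V → F) := by
  have hcont := continuous_fourierInv_of_integrable hi
  refine (hc.ae_eq_iff_eq volume hcont).1 <|
    ae_eq_of_forall_integral_schwartz_smul_eq hc.locallyIntegrable hcont.locallyIntegrable
      fun ψ => ?_
  rw [← integral_schwartz_fourierInv_smul hi, ← integral_schwartz_fourier_smul_of_memLp,
    fourier_fourierInv_eq]

theorem eLpNorm_fourier_toLp_sub_fourier (hf : MemLp f 2) (h₁ : Integrable g) (h₂ : MemLp g 2) :
    eLpNorm (⇑(𝓕 hf.toLp : Lp F 2 (volume : Measure V)) - 𝓕 g) 2 volume =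
      eLpNorm (f - g) 2 volume := by
  have hsub : ⇑(𝓕 hf.toLp : Lp F 2 (volume : Measure V)) - 𝓕 g =ᵐ[volume]
      (𝓕 (hf.sub h₂).toLp : Lp F 2 (volume : Measure V)) := by
    have hlin : 𝓕 (hf.sub h₂).toLp = 𝓕 hf.toLp - 𝓕 h₂.toLp :=
      map_sub (Lp.fourierTransformₗᵢ V F) hf.toLp h₂.toLp
    rw [hlin]
    filter_upwards [coeFn_fourier_toLp h₁ h₂, Lp.coeFn_sub (𝓕 hf.toLp) (𝓕 h₂.toLp)] with w hw hs
    rw [hs, Pi.sub_apply, Pi.sub_apply, hw]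
  rw [eLpNorm_congr_ae hsub, ← Lp.enorm_def, ← eLpNorm_congr_ae (hf.sub h₂).coeFn_toLp,
    ← Lp.enorm_def, ← ofReal_norm, ← ofReal_norm, Lp.norm_fourier_eq]

end L2Fourier

section Lp

variable {E : Type*} [NormedAddCommGroup E]

theorem map_volume_div {a : ℝ} (ha : a ≠ 0) :
    Measure.map (· / a) (volume : Measure ℝ) = ENNReal.ofReal |a| • volume := by
  simpa [div_eq_mul_inv] using Real.map_volume_mul_right (inv_ne_zero ha)

theorem quasiMeasurePreserving_div {a : ℝ} (ha : a ≠ 0) :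
    Measure.QuasiMeasurePreserving (· / a : ℝ → ℝ) :=
  ⟨by fun_prop, by rw [map_volume_div ha]; exact Measure.smul_absolutelyContinuous⟩

theorem eLpNorm_comp_div {a : ℝ} (ha : a ≠ 0) (f : ℝ → E) (p : ℝ≥0∞) :
    eLpNorm (fun v => f (v / a)) p volume =
      ENNReal.ofReal |a| ^ (1 / p).toReal * eLpNorm f p volume := by
  have hemb : MeasurableEmbedding (· / a : ℝ → ℝ) := by
    simpa only [div_eq_mul_inv] using measurableEmbedding_mulRight₀ (inv_ne_zero ha)
  rw [← smul_eq_mul, ← eLpNorm_smul_measure_of_ne_zero (by simpa using ha), ← map_volume_div ha,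
    hemb.eLpNorm_map_measure]
  rfl

theorem tendsto_eLpNorm_sub_indicator {α ι : Type*} [MeasurableSpace α] {μ : Measure α}
    {l : Filter ι} [l.IsCountablyGenerated] {s : ι → Set α} (hs : AECover μ l s) {p : ℝ≥0∞}
    (hp : p ≠ 0) (hp' : p ≠ ⊤) {f : α → E} (hf : MemLp f p μ) :
    Tendsto (fun i => eLpNorm (f - (s i).indicator f) p μ) l (𝓝 0) := by
  have hpos : 0 < p.toReal := ENNReal.toReal_pos hp hp'
  have hlim : Tendsto (fun i => ∫⁻ x, ‖(f - (s i).indicator f) x‖ₑ ^ p.toReal ∂μ) l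
      (𝓝 (∫⁻ _, 0 ∂μ)) := by
    refine tendsto_lintegral_filter_of_dominated_convergence' (fun x => ‖f x‖ₑ ^ p.toReal)
      (.of_forall fun i =>
        (hf.1.sub (hf.1.indicator (hs.measurableSet i))).enorm.pow_const _)
      (.of_forall fun i => .of_forall fun x => ?_)
      (lintegral_rpow_enorm_lt_top_of_eLpNorm_lt_top hp hp' hf.2).ne ?_
    · by_cases hx : x ∈ s i <;> simp [hx, hpos]
    · filter_upwards [hs.ae_eventually_mem] with x hx
      refine tendsto_const_nhds.congr' ?_
      filter_upwards [hx] with i hi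
      simp [hi, hpos]
  have h := hlim.ennrpow_const (1 / p.toReal)
  rw [lintegral_zero, ENNReal.zero_rpow_of_pos (one_div_pos.2 hpos)] at h
  exact h.congr fun i => (eLpNorm_eq_lintegral_rpow_enorm_toReal hp hp').symm

theorem lintegral_Ioi_eq_lintegral_exp_neg (g : ℝ → ℝ≥0∞) :
    ∫⁻ u in Set.Ioi 0, g u = ∫⁻ t, ENNReal.ofReal (Real.exp (-t)) * g (Real.exp (-t)) := by
  have himage : (fun t => Real.exp (-t)) '' Set.univ = Set.Ioi 0 := by
    rw [Set.image_univ, ← Real.range_exp]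
    exact neg_surjective.range_comp Real.exp
  rw [← himage, lintegral_image_eq_lintegral_abs_deriv_mul .univ
    (fun t _ => (hasDerivAt_neg t).exp.hasDerivWithinAt)
    (Real.exp_injective.comp neg_injective).injOn, setLIntegral_univ]
  simp

end Lp

section TriangleWave

open Complex FourierTransform

theorem triangleWave_add_two_mul_int_of_mem_Ico {w : ℝ} (hw : w ∈ Set.Ico (-1) 1) (m : ℤ) :
    triangleWave (w + 2 * m) = (-1) ^ m * w := by
  obtain ⟨hl, hu⟩ := hw
  unfold triangleWave
  obtain ⟨j, rfl | rfl⟩ := Int.even_or_odd' m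
  · have hfloor : ⌊(w + 2 * ((2 * j : ℤ) : ℝ) + 3) / 4⌋ = j := by
      rw [Int.floor_eq_iff]; push_cast; constructor <;> linarith
    rw [hfloor, Even.neg_one_zpow (by simp), abs_of_nonneg] <;> push_cast <;> linarith
  · have hfloor : ⌊(w + 2 * ((2 * j + 1 : ℤ) : ℝ) + 3) / 4⌋ = j + 1 := by
      rw [Int.floor_eq_iff]; push_cast; constructor <;> linarith
    rw [hfloor, Odd.neg_one_zpow (by simp), abs_of_nonpos] <;> push_cast <;> linarith

theorem triangleWave_add_two_mul_int {w : ℝ} (hw : |w| ≤ 1) (m : ℤ) :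
    triangleWave (w + 2 * m) = (-1) ^ m * w := by
  obtain ⟨hl, hu⟩ := abs_le.1 hw
  obtain hu | rfl := hu.lt_or_eq
  · exact triangleWave_add_two_mul_int_of_mem_Ico ⟨hl, hu⟩ m
  · have h := triangleWave_add_two_mul_int_of_mem_Ico (w := -1) (by simp) (m + 1)
    rw [show (1 : ℝ) + 2 * m = -1 + 2 * (m + 1 : ℤ) by push_cast; ring, h,
      zpow_add_one₀ (by simp)]
    ring

theorem exists_eq_add_two_mul_int (w : ℝ) : ∃ w₀ : ℝ, |w₀| ≤ 1 ∧ ∃ m : ℤ, w = w₀ + 2 * m := by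
  refine ⟨2 * (w / 2 - round (w / 2)), ?_, round (w / 2), by ring⟩
  rw [abs_mul, abs_two]
  linarith [abs_sub_round (w / 2)]

theorem triangleWave_of_abs_le_one {w : ℝ} (hw : |w| ≤ 1) : triangleWave w = w := by
  simpa using triangleWave_add_two_mul_int hw 0

theorem abs_triangleWave_le_one (w : ℝ) : |triangleWave w| ≤ 1 := by
  obtain ⟨w₀, hw₀, m, rfl⟩ := exists_eq_add_two_mul_int w
  simpa [triangleWave_add_two_mul_int hw₀, abs_mul, abs_zpow] using hw₀

theorem measurable_triangleWave : Measurable triangleWave := by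
  unfold triangleWave
  fun_prop

theorem fourierChar_int_div_two (n : ℤ) : (Real.fourierChar (n / 2) : ℂ) = (-1) ^ n := by
  rw [Real.fourierChar_apply, ← exp_pi_mul_I, ← exp_int_mul]
  congr 1
  push_cast
  ring

theorem hasSum_odd_fourierChar {x : ℝ} (hx : x ∈ Set.Icc 0 (1 / 2)) :
    HasSum (fun k : ℤ => 1 / (2 * k - 1 : ℂ) ^ 2 * Real.fourierChar ((2 * k - 1) * x))
      (Real.pi ^ 2 * (1 / 4 - x) : ℂ) := by
  have hfourier (n : ℤ) (y : ℝ) :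
      fourier n (y : UnitAddCircle) = (Real.fourierChar (n * y) : ℂ) := by
    rw [fourier_coe_apply, Real.fourierChar_apply]
    congr 1
    push_cast
    ring
  have hshift (n : ℤ) : (Real.fourierChar (n * (x + 1 / 2)) : ℂ) =
      (-1) ^ n * Real.fourierChar (n * x) := by
    rw [← fourierChar_int_div_two, mul_add, AddChar.map_add_eq_mul, Circle.coe_mul, mul_comm,
      mul_one_div]
  have hdiff := ((hasSum_one_div_pow_mul_fourier_mul_bernoulliFun le_rfl (x := x)
    ⟨hx.1, by linarith [hx.2]⟩).sub (hasSum_one_div_pow_mul_fourier_mul_bernoulliFun le_rfl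
    (x := x + 1 / 2) ⟨by linarith [hx.1], by linarith [hx.2]⟩)).mul_left (1 / 2)
  simp only [hfourier, hshift] at hdiff
  have hodd : Function.Injective fun k : ℤ => 2 * k - 1 := fun a b h => by grind
  rw [← hodd.hasSum_iff] at hdiff
  · convert! hdiff using 1
    · ext k
      rw [Function.comp_apply, Odd.neg_one_zpow ⟨k - 1, by ring⟩]
      push_cast
      ring
    · simp only [bernoulliFun_two, Nat.factorial]
      push_cast
      linear_combination (Real.pi ^ 2 * (1 / 4 - x) : ℂ) * I_sq
  · intro n hn
    have heven : Even n := Int.not_odd_iff_even.1 fun ⟨j, hj⟩ => hn ⟨j + 1, by grind⟩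
    simp [heven.neg_one_zpow]

/-- The coefficients of the Boas series, which are the Fourier coefficients of the triangle wave
up to the factor `-iπ²/4`. -/
noncomputable def boasCoeff (k : ℤ) : ℝ :=
  (-1) ^ (k + 1) / (2 * k - 1) ^ 2

theorem hasSum_boasCoeff_mul_fourierChar_of_abs_le {u : ℝ} (hu : |u| ≤ 1 / 2) :
    HasSum (fun k : ℤ => (boasCoeff k : ℂ) * Real.fourierChar (-((k - 1 / 2) * u)))
      (-I * (Real.pi ^ 2 / 4) * (2 * u : ℝ)) := by
  obtain ⟨hl, hr⟩ := abs_le.1 hu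
  have hquarter : (Real.fourierChar (-(1 / 4)) : ℂ) = -I := by
    rw [Real.fourierChar_apply, ← exp_neg_pi_div_two_mul_I]
    congr 1
    push_cast
    ring
  have hchar (k : ℤ) : (Real.fourierChar ((2 * k - 1) * (1 / 4 - u / 2)) : ℂ) =
      (-1) ^ k * -I * Real.fourierChar (-((k - 1 / 2) * u)) := by
    rw [← fourierChar_int_div_two, ← hquarter, ← Circle.coe_mul, ← Circle.coe_mul,
      ← AddChar.map_add_eq_mul, ← AddChar.map_add_eq_mul]
    ring_nf
  convert! (hasSum_odd_fourierChar (x := 1 / 4 - u / 2)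
    ⟨by linarith, by linarith⟩).mul_left (-I) using 1
  · ext k
    rw [hchar, boasCoeff, zpow_add_one₀ (by simp)]
    push_cast
    linear_combination (-(-1) ^ k / (2 * k - 1 : ℂ) ^ 2 *
      Real.fourierChar (-((k - 1 / 2) * u))) * I_sq
  · push_cast
    ring

theorem hasSum_boasCoeff_mul_fourierChar (u : ℝ) :
    HasSum (fun k : ℤ => (boasCoeff k : ℂ) * Real.fourierChar (-((k - 1 / 2) * u)))
      (-I * (Real.pi ^ 2 / 4) * triangleWave (2 * u)) := by
  obtain ⟨w, hw, m, hm⟩ := exists_eq_add_two_mul_int (2 * u)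
  have hu : u = w / 2 + m := by linarith
  have hchar (k : ℤ) : (Real.fourierChar (-((k - 1 / 2) * u)) : ℂ) =
      (-1) ^ m * Real.fourierChar (-((k - 1 / 2) * (w / 2))) := by
    have hsign : (-1 : ℂ) ^ m = (-1) ^ (-((2 * k - 1) * m)) := by
      have hodd : Odd (-(2 * k - 1)) := ⟨-k, by ring⟩
      rw [← neg_mul, zpow_mul, hodd.neg_one_zpow]
    rw [hsign, ← fourierChar_int_div_two, ← Circle.coe_mul, ← AddChar.map_add_eq_mul, hu]
    push_cast
    ring_nf
  have hw' : |w / 2| ≤ 1 / 2 := by rw [abs_div, abs_two]; linarith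
  convert! (hasSum_boasCoeff_mul_fourierChar_of_abs_le hw').mul_left ((-1 : ℂ) ^ m) using 1
  · ext k
    rw [hchar, mul_left_comm]
  · rw [hm, triangleWave_add_two_mul_int hw]
    push_cast
    ring

theorem summable_boasCoeff : Summable fun k : ℤ => (boasCoeff k : ℂ) := by
  simpa using (hasSum_boasCoeff_mul_fourierChar 0).summable

end TriangleWave

section LogLift

open FourierTransform

variable {c : ℝ} {f : ℝ → ℂ}

/-- The function `t ↦ e^{-ct} f(e^{-t})` on `ℝ`, whose Fourier transform is the Mellin transform
of `f` on the line `Re s = c`; the substitution `u = e^{-t}` is the one of `mellin_eq_fourier`. -/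
noncomputable def logLift (c : ℝ) (f : ℝ → ℂ) (t : ℝ) : ℂ :=
  Real.exp (-c * t) • f (Real.exp (-t))

theorem exp_mul_mul_comp_mul_exp (c : ℝ) (f : ℝ → ℂ) {x : ℝ} (hx : 0 < x) (s : ℝ) :
    (Real.exp (s * c) : ℂ) * f (x * Real.exp s) =
      ((x ^ (-c) : ℝ) : ℂ) * logLift c f (-Real.log x - s) := by
  have hexp : Real.exp (s * c) = x ^ (-c) * Real.exp (-c * (-Real.log x - s)) := by
    rw [Real.rpow_def_of_pos hx, ← Real.exp_add]
    ring_nf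
  rw [logLift, hexp, neg_sub, sub_neg_eq_add, add_comm s, Real.exp_add, Real.exp_log hx,
    Complex.real_smul, Complex.ofReal_mul, mul_assoc]

theorem eq_rpow_mul_logLift (c : ℝ) (f : ℝ → ℂ) {x : ℝ} (hx : 0 < x) :
    f x = ((x ^ (-c) : ℝ) : ℂ) * logLift c f (-Real.log x) := by
  simpa using exp_mul_mul_comp_mul_exp c f hx 0

theorem logLift_eq_iff {G : ℝ → ℂ} :
    logLift c f = G ↔ ∀ x : ℝ, 0 < x → f x = ((x ^ (-c) : ℝ) : ℂ) * G (-Real.log x) := by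
  refine ⟨fun h x hx => h ▸ eq_rpow_mul_logLift c f hx, fun h => funext fun t => ?_⟩
  rw [logLift, h _ (Real.exp_pos _), Real.log_exp, neg_neg, ← Real.exp_mul, Complex.real_smul,
    ← mul_assoc, ← Complex.ofReal_mul, ← Real.exp_add]
  simp [mul_comm]

theorem continuous_logLift (c : ℝ) (hf : ContinuousOn f (Set.Ioi 0)) :
    Continuous (logLift c f) :=
  (by fun_prop : Continuous fun t : ℝ => Real.exp (-c * t)).smul
    (hf.comp_continuous (by fun_prop) fun t => Real.exp_pos (-t))

theorem memLp_logLift (hX : MemX2 c f) (hf : ContinuousOn f (Set.Ioi 0)) :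
    MemLp (logLift c f) 2 := by
  refine ⟨(continuous_logLift c hf).aestronglyMeasurable, ?_⟩
  have h := hX.2
  rw [eLpNorm_lt_top_iff_lintegral_rpow_enorm_lt_top (by simp) (by simp)] at h ⊢
  rw [lintegral_Ioi_eq_lintegral_exp_neg] at h
  convert! h using 3 with t
  have hweight : Real.exp (-t) * (Real.exp (-t) ^ (c - 1 / 2)) ^ 2 = Real.exp (-c * t) ^ 2 := by
    rw [← Real.exp_mul, ← Real.exp_nat_mul, ← Real.exp_nat_mul, ← Real.exp_add]
    ring_nf
  have henorm (r : ℝ) : ‖(r : ℂ)‖ₑ ^ 2 = ENNReal.ofReal (r ^ 2) := by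
    rw [← ofReal_norm, Complex.norm_real, ← ENNReal.ofReal_pow (norm_nonneg _), Real.norm_eq_abs,
      sq_abs]
  simp only [logLift, ENNReal.toReal_ofNat, ENNReal.rpow_ofNat, enorm_mul, Complex.real_smul,
    mul_pow, henorm]
  rw [← mul_assoc, ← ENNReal.ofReal_mul (Real.exp_pos _).le, hweight]

theorem logLift_indicator_Ioc (c : ℝ) (f : ℝ → ℂ) {ρ : ℝ} (hρ : 0 < ρ) :
    logLift c ((Set.Ioc (1 / ρ) ρ).indicator f) =
      (Set.Ico (-Real.log ρ) (Real.log ρ)).indicator (logLift c f) := by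
  ext t
  have hmem : Real.exp (-t) ∈ Set.Ioc (1 / ρ) ρ ↔ t ∈ Set.Ico (-Real.log ρ) (Real.log ρ) := by
    rw [Set.mem_Ioc, Set.mem_Ico, one_div, ← Real.exp_log hρ, ← Real.exp_neg, Real.exp_lt_exp,
      Real.exp_le_exp, Real.log_exp, neg_lt_neg_iff, neg_le, and_comm]
  by_cases ht : t ∈ Set.Ico (-Real.log ρ) (Real.log ρ)
  · simp only [logLift, Set.indicator_of_mem ht, Set.indicator_of_mem (hmem.2 ht)]
  · simp only [logLift, Set.indicator_of_notMem ht, Set.indicator_of_notMem (mt hmem.1 ht),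
      smul_zero]

theorem truncatedMellin_eq_fourier (c : ℝ) (f : ℝ → ℂ) {ρ : ℝ} (hρ : 1 ≤ ρ) (v : ℝ) :
    truncatedMellin c f ρ v =
      𝓕 ((Set.Ico (-Real.log ρ) (Real.log ρ)).indicator (logLift c f)) (v / (2 * Real.pi)) := by
  have hρ₀ : 0 < ρ := by linarith
  have hinv : 1 / ρ ≤ ρ := ((div_le_one hρ₀).2 hρ).trans hρ
  have hsub : Set.Ioc (1 / ρ) ρ ⊆ Set.Ioi 0 := fun u hu => (one_div_pos.2 hρ₀).trans hu.1
  have hmellin : truncatedMellin c f ρ v =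
      mellin ((Set.Ioc (1 / ρ) ρ).indicator f) (c + Complex.I * v) := by
    simp only [mellin, smul_eq_mul, ← Set.indicator_mul_right (Set.Ioc (1 / ρ) ρ)
      (fun u : ℝ => (u : ℂ) ^ ((c : ℂ) + Complex.I * v - 1))]
    rw [setIntegral_indicator measurableSet_Ioc, Set.inter_eq_right.2 hsub, truncatedMellin,
      intervalIntegral.integral_of_le hinv]
    simp only [mul_comm]
  have hre : ((c : ℂ) + Complex.I * v).re = c := by simp
  have him : ((c : ℂ) + Complex.I * v).im = v := by simp
  rw [hmellin, mellin_eq_fourier, ← logLift_indicator_Ioc c f hρ₀, hre, him]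
  rfl

end LogLift

section MellinTransform

open FourierTransform

variable {c : ℝ} {f : ℝ → ℂ}

theorem integrable_indicator_logLift (c r : ℝ) (hf : ContinuousOn f (Set.Ioi 0)) :
    Integrable ((Set.Ico (-r) r).indicator (logLift c f)) :=
  ((continuous_logLift c hf).integrableOn_Icc.mono_set
    Set.Ico_subset_Icc_self).integrable_indicator measurableSet_Ico

theorem isMellinTransform_fourier (hf : ContinuousOn f (Set.Ioi 0)) (h₂ : MemLp (logLift c f) 2) :
    IsMellinTransform c f
      (fun v => (𝓕 h₂.toLp : Lp ℂ 2 (volume : Measure ℝ)) (v / (2 * Real.pi))) := by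
  have hpi : 2 * Real.pi ≠ 0 := Real.two_pi_pos.ne'
  have hconst : ENNReal.ofReal |2 * Real.pi| ^ (1 / 2 : ℝ≥0∞).toReal ≠ ⊤ :=
    ENNReal.rpow_ne_top_of_nonneg ENNReal.toReal_nonneg ENNReal.ofReal_ne_top
  refine ⟨⟨(Lp.aestronglyMeasurable _).comp_quasiMeasurePreserving
    (quasiMeasurePreserving_div hpi), ?_⟩, ?_⟩
  · rw [eLpNorm_comp_div hpi]
    exact ENNReal.mul_lt_top hconst.lt_top (Lp.memLp _).2
  · have hcover : AECover (volume : Measure ℝ) atTop fun ρ : ℝ =>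
        Set.Ico (-Real.log ρ) (Real.log ρ) :=
      aecover_Ico (tendsto_neg_atTop_atBot.comp Real.tendsto_log_atTop) Real.tendsto_log_atTop
    have h := ENNReal.Tendsto.const_mul
      (tendsto_eLpNorm_sub_indicator hcover (by simp) (by simp) h₂) (Or.inr hconst)
    rw [mul_zero] at h
    refine h.congr' ?_
    filter_upwards [eventually_ge_atTop 1] with ρ hρ
    simp only [truncatedMellin_eq_fourier c f hρ]
    rw [← eLpNorm_fourier_toLp_sub_fourier h₂ (integrable_indicator_logLift c _ hf)
      (h₂.indicator measurableSet_Ico), ← eLpNorm_comp_div hpi]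
    rfl

theorem aestronglyMeasurable_truncatedMellin (c : ℝ) (hf : ContinuousOn f (Set.Ioi 0)) {ρ : ℝ}
    (hρ : 1 ≤ ρ) : AEStronglyMeasurable (truncatedMellin c f ρ) volume := by
  rw [funext (truncatedMellin_eq_fourier c f hρ)]
  exact ((continuous_fourier_of_integrable (integrable_indicator_logLift c _ hf)).comp
    (continuous_id.div_const _)).aestronglyMeasurable

theorem IsMellinTransform.ae_eq {g g' : ℝ → ℂ} (hg : IsMellinTransform c f g)
    (hg' : IsMellinTransform c f g') (hf : ContinuousOn f (Set.Ioi 0)) : g =ᵐ[volume] g' := by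
  have hle : eLpNorm (g - g') 2 volume ≤ 0 := by
    have hsum := hg.2.add hg'.2
    rw [add_zero] at hsum
    refine ge_of_tendsto hsum ?_
    filter_upwards [eventually_ge_atTop 1] with ρ hρ
    have hm := aestronglyMeasurable_truncatedMellin c hf hρ
    convert! eLpNorm_sub_le (hg.1.1.sub hm) (hg'.1.1.sub hm) one_le_two using 2
    exact (sub_sub_sub_cancel_right g g' _).symm
  rw [nonpos_iff_eq_zero, eLpNorm_eq_zero_iff (hg.1.1.sub hg'.1.1) two_ne_zero] at hle
  exact (sub_ae_eq_zero _ _).1 hle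

theorem isMellinTransform_mellinTransform (hX : MemX2 c f) (hf : ContinuousOn f (Set.Ioi 0)) :
    IsMellinTransform c f (mellinTransform c f) :=
  Classical.epsilon_spec ⟨_, isMellinTransform_fourier hf (memLp_logLift hX hf)⟩

theorem mellinTransform_ae_eq_fourier (hX : MemX2 c f) (hf : ContinuousOn f (Set.Ioi 0)) :
    mellinTransform c f =ᵐ[volume] fun v =>
      (𝓕 (memLp_logLift hX hf).toLp : Lp ℂ 2 (volume : Measure ℝ)) (v / (2 * Real.pi)) :=
  (isMellinTransform_mellinTransform hX hf).ae_eq (isMellinTransform_fourier hf _) hf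

end MellinTransform

section Represents

open FourierTransform

variable {q : ℝ≥0∞} {c : ℝ} {f g φ ψ : ℝ → ℂ}

theorem integral_mul_cpow_eq_fourierInv (c : ℝ) (φ : ℝ → ℂ) {x : ℝ} (hx : 0 < x) :
    1 / (2 * (Real.pi : ℂ)) * ∫ v : ℝ, φ v * (x : ℂ) ^ (-(c : ℂ) - Complex.I * (v : ℂ)) =
      ((x ^ (-c) : ℝ) : ℂ) * 𝓕⁻ (fun w => φ (2 * Real.pi * w)) (-Real.log x) := by
  have h := mellinInv_eq_fourierInv c (fun s => φ s.im) hx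
  have him (w : ℝ) : ((c : ℂ) + 2 * Real.pi * w * Complex.I).im = 2 * Real.pi * w := by simp
  simp only [mellinInv, him, smul_eq_mul, Complex.real_smul] at h
  rw [Complex.ofReal_cpow hx.le, Complex.ofReal_neg, ← h]
  push_cast
  congr 2 with v
  simp only [Complex.add_im, Complex.ofReal_im, Complex.mul_im, Complex.ofReal_re, Complex.I_re,
    Complex.I_im]
  ring_nf

theorem represents_iff : Represents q c f φ ↔
    Integrable φ ∧ MemLp φ q volume ∧ logLift c f = 𝓕⁻ (fun w => φ (2 * Real.pi * w)) := by
  simp only [logLift_eq_iff, Represents]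
  refine and_congr_right' (and_congr_right' (forall₂_congr fun x hx => ?_))
  rw [integral_mul_cpow_eq_fourierInv c φ hx]

theorem represents_one_of_logLift_eq (hφ : Integrable φ)
    (h : logLift c f = 𝓕⁻ (fun w => φ (2 * Real.pi * w))) : Represents 1 c f φ :=
  represents_iff.2 ⟨hφ, memLp_one_iff_integrable.2 hφ, h⟩

theorem integrable_comp_two_pi_mul (hφ : Integrable φ) :
    Integrable fun w => φ (2 * Real.pi * w) :=
  hφ.comp_mul_left' Real.two_pi_pos.ne'

theorem integrable_mul_cpow (hφ : Integrable φ) (c : ℝ) {x : ℝ} (hx : 0 < x) :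
    Integrable fun v : ℝ => φ v * (x : ℂ) ^ (-(c : ℂ) - Complex.I * (v : ℂ)) := by
  refine hφ.mul_bdd (c := x ^ (-c)) ?_ (.of_forall fun v => ?_)
  · have hx₀ : (x : ℂ) ≠ 0 := Complex.ofReal_ne_zero.2 hx.ne'
    exact (Continuous.const_cpow (by fun_prop) (Or.inl hx₀)).aestronglyMeasurable
  · simp [Complex.norm_cpow_eq_rpow_re_of_pos hx]

theorem Represents.sub (hf : Represents q c f φ) (hg : Represents q c g ψ) :
    Represents q c (f - g) (φ - ψ) := by
  refine ⟨hf.1.sub hg.1, hf.2.1.sub hg.2.1, fun x hx => ?_⟩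
  simp only [Pi.sub_apply, sub_mul]
  rw [integral_sub (integrable_mul_cpow hf.1 c hx) (integrable_mul_cpow hg.1 c hx), mul_sub,
    hf.2.2 x hx, hg.2.2 x hx]

theorem Represents.const_mul (hf : Represents q c f φ) (a : ℂ) :
    Represents q c (fun x => a * f x) (fun v => a * φ v) := by
  refine ⟨hf.1.const_mul a, hf.2.1.const_mul a, fun x hx => ?_⟩
  simp only [mul_assoc, integral_const_mul]
  rw [hf.2.2 x hx, mul_left_comm]

theorem Represents.congr_ae (hφ : Represents q c f φ) (hae : φ =ᵐ[volume] ψ) :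
    Represents q c f ψ := by
  refine ⟨hφ.1.congr hae, hφ.2.1.ae_eq hae, fun x hx => ?_⟩
  rw [hφ.2.2 x hx]
  congr 1
  refine integral_congr_ae ?_
  filter_upwards [hae] with v hv
  rw [hv]

theorem Represents.ae_eq (hφ : Represents q c f φ) (hψ : Represents q c f ψ) :
    φ =ᵐ[volume] ψ := by
  have hpi := Real.two_pi_pos.ne'
  have hae := ae_eq_of_fourierInv_eq (integrable_comp_two_pi_mul hφ.1)
    (integrable_comp_two_pi_mul hψ.1)
    ((represents_iff.1 hφ).2.2.symm.trans (represents_iff.1 hψ).2.2)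
  filter_upwards [(quasiMeasurePreserving_div hpi).ae hae] with v hv
  simpa only [mul_div_cancel₀ _ hpi] using hv

theorem Represents.norm_le (h : Represents q c f φ) {x : ℝ} (hx : 0 < x) :
    ‖f x‖ ≤ x ^ (-c) / (2 * Real.pi) * ∫ v, ‖φ v‖ := by
  have hbound : ‖∫ v : ℝ, φ v * (x : ℂ) ^ (-(c : ℂ) - Complex.I * (v : ℂ))‖ ≤
      (∫ v, ‖φ v‖) * x ^ (-c) := by
    refine (norm_integral_le_integral_norm _).trans_eq ?_
    rw [← integral_mul_const]
    simp [Complex.norm_cpow_eq_rpow_re_of_pos hx]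
  have hpi : ‖1 / (2 * (Real.pi : ℂ))‖ = 1 / (2 * Real.pi) := by simp [abs_of_pos Real.pi_pos]
  calc ‖f x‖ ≤ 1 / (2 * Real.pi) * ((∫ v, ‖φ v‖) * x ^ (-c)) := by
        rw [h.2.2 x hx, norm_mul, hpi]
        gcongr
    _ = x ^ (-c) / (2 * Real.pi) * ∫ v, ‖φ v‖ := by ring

theorem Represents.normXInfty_le (h : Represents q c f φ) :
    normXInfty c f ≤ ENNReal.ofReal (1 / (2 * Real.pi)) * ∫⁻ v, ‖φ v‖ₑ := by
  refine iSup_le fun ⟨x, hx⟩ => ?_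
  have hcancel : x ^ c * x ^ (-c) = 1 := by
    rw [← Real.rpow_add hx, add_neg_cancel, Real.rpow_zero]
  rw [← ofReal_integral_norm_eq_lintegral_enorm h.1, ← ENNReal.ofReal_mul (by positivity),
    ← ofReal_norm, norm_mul, Complex.norm_real, Real.norm_of_nonneg (Real.rpow_nonneg hx.le c)]
  refine ENNReal.ofReal_le_ofReal ?_
  calc x ^ c * ‖f x‖ ≤ x ^ c * (x ^ (-c) / (2 * Real.pi) * ∫ v, ‖φ v‖) :=
        mul_le_mul_of_nonneg_left (h.norm_le hx) (Real.rpow_nonneg hx.le c)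
    _ = x ^ c * x ^ (-c) * (1 / (2 * Real.pi) * ∫ v, ‖φ v‖) := by ring
    _ = 1 / (2 * Real.pi) * ∫ v, ‖φ v‖ := by rw [hcancel, one_mul]

theorem represents_mellinTransform (hf : MemM2 c f) :
    Represents 1 c f (mellinTransform c f) := by
  obtain ⟨hX, hc, hi⟩ := hf
  have hpi := Real.two_pi_pos.ne'
  have hae := mellinTransform_ae_eq_fourier hX hc
  have hi' := hi.congr hae
  refine (represents_one_of_logLift_eq hi' ?_).congr_ae hae.symm
  simp only [mul_div_cancel_left₀ _ hpi]
  exact eq_fourierInv_fourier_toLp (continuous_logLift c hc) (memLp_logLift hX hc)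
    ((integrable_comp_div_iff _ hpi).1 hi')

end Represents

section MellinDeriv

open FourierTransform

variable {q : ℝ≥0∞} {c : ℝ} {f φ : ℝ → ℂ}

theorem hasMellinDeriv_of_hasDerivAt_logLift {x : ℝ} (hx : 0 < x) {d : ℂ}
    (h : HasDerivAt (logLift c f) d (-Real.log x)) :
    HasMellinDeriv c f x (-(((x ^ (-c) : ℝ) : ℂ) * d)) := by
  have hlog : HasDerivAt (fun y : ℝ => -Real.log x - Real.log y) (-1) 1 := by
    simpa using (Real.hasDerivAt_log one_ne_zero).const_sub (-Real.log x)
  have hcomp := (HasDerivAt.scomp_of_eq (1 : ℝ) h hlog (by simp)).const_mul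
    ((x ^ (-c) : ℝ) : ℂ)
  rw [neg_one_smul, mul_neg, hasDerivAt_iff_tendsto_slope] at hcomp
  refine hcomp.congr' ?_
  filter_upwards [nhdsWithin_le_nhds (lt_mem_nhds (zero_lt_one' ℝ))] with y hy
  have hfy := exp_mul_mul_comp_mul_exp c f hx (Real.log y)
  rw [← Real.rpow_def_of_pos hy, Real.exp_log hy, mul_comm x] at hfy
  rw [slope_def_module, mellinQuotient, hfy, eq_rpow_mul_logLift c f hx, Complex.real_smul,
    div_eq_inv_mul]
  simp

theorem Represents.hasMellinDeriv (h : Represents q c f φ)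
    (hv : Integrable fun v : ℝ => (v : ℂ) * φ v) {x : ℝ} (hx : 0 < x) :
    HasMellinDeriv c f x (1 / (2 * (Real.pi : ℂ)) * ∫ v : ℝ,
      -Complex.I * (v * φ v) * (x : ℂ) ^ (-(c : ℂ) - Complex.I * (v : ℂ))) := by
  have hφ := integrable_comp_two_pi_mul h.1
  have hw : Integrable fun w : ℝ => w • φ (2 * Real.pi * w) := by
    convert! (integrable_comp_two_pi_mul hv).const_mul (1 / (2 * Real.pi : ℂ)) using 2 with w
    have hpi := Complex.ofReal_ne_zero.2 Real.pi_ne_zero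
    rw [Complex.real_smul]
    push_cast
    field_simp
  have hderiv := hasDerivAt_fourierInv hφ hw (-Real.log x)
  rw [← (represents_iff.1 h).2.2] at hderiv
  convert! hasMellinDeriv_of_hasDerivAt_logLift hx hderiv using 1
  rw [integral_mul_cpow_eq_fourierInv c _ hx, ← mul_neg, Real.fourierInv_eq, Real.fourierInv_eq,
    ← integral_neg]
  congr 2 with w
  rw [← smul_neg]
  congr 1
  push_cast
  rw [smul_eq_mul]
  ring

theorem represents_mellinDeriv (h : Represents q c f φ)
    (hv : Integrable fun v : ℝ => (v : ℂ) * φ v) :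
    Represents 1 c (mellinDeriv c f) fun v => -Complex.I * (v * φ v) :=
  ⟨hv.const_mul _, memLp_one_iff_integrable.2 (hv.const_mul _), fun _ hx =>
    (h.hasMellinDeriv hv hx).limUnder_eq⟩

end MellinDeriv

section BoasSeries

open FourierTransform

variable {q : ℝ≥0∞} {c : ℝ} {f φ : ℝ → ℂ}

theorem boasTerm_eq_boasCoeff_mul_logLift (c T : ℝ) (f : ℝ → ℂ) {x : ℝ} (hx : 0 < x) (k : ℤ) :
    boasTerm c T f x k = ((x ^ (-c) : ℝ) : ℂ) *
      ((boasCoeff k : ℂ) * logLift c f (-Real.log x - (k - 1 / 2) / T)) := by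
  rw [mul_left_comm, ← exp_mul_mul_comp_mul_exp c f hx, ← mul_assoc, ← Complex.ofReal_mul,
    div_mul_eq_mul_div]
  rfl

theorem Represents.hasSum_boasTerm (h : Represents q c f φ) (T : ℝ) {x : ℝ} (hx : 0 < x) :
    HasSum (boasTerm c T f x) (1 / (2 * (Real.pi : ℂ)) * ∫ v : ℝ,
      (-Complex.I * (Real.pi ^ 2 / 4) * triangleWave (v / (Real.pi * T)) * φ v) *
        (x : ℂ) ^ (-(c : ℂ) - Complex.I * (v : ℂ))) := by
  have hm (w : ℝ) : HasSum
      (fun k : ℤ => (boasCoeff k : ℂ) * Real.fourierChar (-inner ℝ w ((k - 1 / 2) / T)))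
      (-Complex.I * (Real.pi ^ 2 / 4) * triangleWave (2 * Real.pi * w / (Real.pi * T))) := by
    have hinner (k : ℤ) : inner ℝ w ((k - 1 / 2) / T) = (k - 1 / 2) * (w / T) := by
      rw [Real.inner_apply]
      ring
    have hwave : 2 * Real.pi * w / (Real.pi * T) = 2 * (w / T) := by
      rw [mul_comm 2, mul_assoc, mul_div_mul_left _ _ Real.pi_ne_zero, mul_div_assoc]
    simpa only [hinner, hwave] using hasSum_boasCoeff_mul_fourierChar (w / T)
  have hsum := (hasSum_smul_fourierInv_sub summable_boasCoeff hm (integrable_comp_two_pi_mul h.1)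
    (-Real.log x)).mul_left ((x ^ (-c) : ℝ) : ℂ)
  rw [← (represents_iff.1 h).2.2] at hsum
  simpa only [integral_mul_cpow_eq_fourierInv c _ hx,
    funext (boasTerm_eq_boasCoeff_mul_logLift c T f hx), smul_eq_mul] using hsum

theorem integrable_triangleWave_mul (T : ℝ) (hφ : Integrable φ) :
    Integrable fun v : ℝ => (triangleWave (v / (Real.pi * T)) : ℂ) * φ v := by
  refine hφ.bdd_mul (c := 1) ?_ (.of_forall fun v => ?_)
  · exact (Complex.measurable_ofReal.comp
      (measurable_triangleWave.comp (measurable_id.div_const _))).aestronglyMeasurable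
  · rw [Complex.norm_real]
    exact abs_triangleWave_le_one _

theorem represents_tsum_boasTerm (h : Represents q c f φ) (T : ℝ) :
    Represents 1 c (fun x => ∑' k : ℤ, boasTerm c T f x k) fun v =>
      -Complex.I * (Real.pi ^ 2 / 4) * triangleWave (v / (Real.pi * T)) * φ v := by
  have hi : Integrable fun v : ℝ =>
      -Complex.I * (Real.pi ^ 2 / 4) * triangleWave (v / (Real.pi * T)) * φ v := by
    simp only [mul_assoc (-Complex.I * (Real.pi ^ 2 / 4))]
    exact (integrable_triangleWave_mul T h.1).const_mul _
  exact ⟨hi, memLp_one_iff_integrable.2 hi, fun x hx => (h.hasSum_boasTerm T hx).tsum_eq⟩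

end BoasSeries

section BernsteinDistance

variable {c σ : ℝ} {f φ : ℝ → ℂ}

theorem memB2_zero (c σ : ℝ) : MemB2 c σ 0 := by
  have hX : MemX2 c 0 := by simp [MemX2]
  have hc : ContinuousOn (0 : ℝ → ℂ) (Set.Ioi 0) := continuousOn_const
  have hzero : IsMellinTransform c 0 0 := ⟨MemLp.zero, by simp [truncatedMellin]⟩
  refine ⟨hX, hc, ?_⟩
  filter_upwards [(isMellinTransform_mellinTransform hX hc).ae_eq hzero hc] with v hv _
  exact hv

theorem MemB2.memM2 (hf : MemB2 c σ f) : MemM2 c f := by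
  obtain ⟨hX, hc, hsupp⟩ := hf
  have hon : IntegrableOn (mellinTransform c f) (Set.Icc (-σ) σ) :=
    ((isMellinTransform_mellinTransform hX hc).1.restrict _).integrable one_le_two
  refine ⟨hX, hc, hon.integrable_of_ae_notMem_eq_zero ?_⟩
  filter_upwards [hsupp] with v hv hmem
  exact hv (not_le.1 fun hle => hmem (abs_le.1 hle))

theorem setLIntegral_enorm_le_distB2 (σ : ℝ) (hf : Represents 1 c f φ) :
    ∫⁻ v in {v : ℝ | σ < |v|}, ‖φ v‖ₑ ≤ distB2 1 c σ f := by
  refine le_iInf₂ fun g hg => le_iInf₂ fun ψ hψ => ?_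
  have hae : φ - mellinTransform c g =ᵐ[volume] ψ :=
    (hf.sub (represents_mellinTransform hg.memM2)).ae_eq hψ
  have hmeas : MeasurableSet {v : ℝ | σ < |v|} :=
    measurableSet_lt measurable_const measurable_norm
  calc ∫⁻ v in {v : ℝ | σ < |v|}, ‖φ v‖ₑ = ∫⁻ v in {v : ℝ | σ < |v|}, ‖ψ v‖ₑ := by
        refine setLIntegral_congr_fun_ae hmeas ?_
        filter_upwards [hae, hg.2.2] with v hv hzero hσ
        rw [← hv, Pi.sub_apply, hzero hσ, sub_zero]
    _ ≤ ∫⁻ v, ‖ψ v‖ₑ := setLIntegral_le_lintegral _ _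
    _ = eLpNorm ψ 1 volume := eLpNorm_one_eq_lintegral_enorm.symm

theorem Represents.distB2_lt_top {q : ℝ≥0∞} (hf : Represents q c f φ) (σ : ℝ) :
    distB2 q c σ f < ⊤ :=
  calc distB2 q c σ f ≤ normG q c (f - 0) := iInf₂_le 0 (memB2_zero c σ)
    _ = normG q c f := by rw [sub_zero]
    _ ≤ eLpNorm φ q volume := iInf₂_le φ hf
    _ < ⊤ := hf.2.1.2

end BernsteinDistance

section Remainder

variable {q : ℝ≥0∞} {c T : ℝ} {f φ : ℝ → ℂ}

/-- The factor `v - πT φ(v/(πT))`, where `φ` is the triangle wave, by which `R^B_{πT}` acts on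
representing functions, up to the factor `-i`. -/
noncomputable def boasMultiplier (T v : ℝ) : ℝ :=
  v - Real.pi * T * triangleWave (v / (Real.pi * T))

theorem boasMultiplier_eq_zero (hT : 0 < T) {v : ℝ} (hv : |v| ≤ Real.pi * T) :
    boasMultiplier T v = 0 := by
  have hpos : 0 < Real.pi * T := mul_pos Real.pi_pos hT
  have hle : |v / (Real.pi * T)| ≤ 1 := by
    rw [abs_div, abs_of_pos hpos]
    exact (div_le_one hpos).2 hv
  rw [boasMultiplier, triangleWave_of_abs_le_one hle, mul_div_cancel₀ _ hpos.ne', sub_self]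

theorem abs_boasMultiplier_le (hT : 0 ≤ T) (v : ℝ) : |boasMultiplier T v| ≤ |v| + Real.pi * T := by
  have hpos : 0 ≤ Real.pi * T := by positivity
  refine (abs_sub _ _).trans ?_
  rw [abs_mul, abs_of_nonneg hpos]
  linarith [mul_le_of_le_one_right hpos (abs_triangleWave_le_one (v / (Real.pi * T)))]

theorem integrable_boasMultiplier_mul (T : ℝ) (hφ : Integrable φ)
    (hv : Integrable fun v : ℝ => (v : ℂ) * φ v) :
    Integrable fun v : ℝ => (boasMultiplier T v : ℂ) * φ v := by
  convert! hv.sub ((integrable_triangleWave_mul T hφ).const_mul (Real.pi * T : ℂ)) using 2 with v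
  simp only [Pi.sub_apply, boasMultiplier]
  push_cast
  ring

theorem represents_boasRemainder (h : Represents q c f φ)
    (hv : Integrable fun v : ℝ => (v : ℂ) * φ v) (T : ℝ) :
    Represents 1 c (boasRemainder c T f) fun v => -Complex.I * (boasMultiplier T v * φ v) := by
  convert! (represents_mellinDeriv h hv).sub
    ((represents_tsum_boasTerm h T).const_mul ((4 * T / Real.pi : ℝ) : ℂ)) using 1
  ext v
  simp only [Pi.sub_apply, boasMultiplier]
  push_cast
  field_simp
  ring

theorem boasRemainder_eq_setIntegral (h : Represents q c f φ)
    (hv : Integrable fun v : ℝ => (v : ℂ) * φ v) (hT : 0 < T) {x : ℝ} (hx : 0 < x) :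
    boasRemainder c T f x = 1 / (2 * (Real.pi : ℂ) * Complex.I) *
      ∫ v in {v : ℝ | Real.pi * T ≤ |v|},
        (boasMultiplier T v : ℂ) * φ v * (x : ℂ) ^ (-(c : ℂ) - Complex.I * (v : ℂ)) := by
  have hI : 1 / (2 * (Real.pi : ℂ) * Complex.I) = 1 / (2 * (Real.pi : ℂ)) * -Complex.I := by
    rw [← div_div, div_eq_mul_inv, Complex.inv_I]
  rw [(represents_boasRemainder h hv T).2.2 x hx, setIntegral_eq_integral_of_forall_compl_eq_zero,
    hI]
  · simp only [mul_assoc, integral_const_mul]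
  · intro v hvT
    rw [boasMultiplier_eq_zero hT (not_le.1 hvT).le]
    simp

theorem integrable_abs_add_mul_norm (a : ℝ) (hφ : Integrable φ)
    (hv : Integrable fun v : ℝ => (v : ℂ) * φ v) :
    Integrable fun v : ℝ => (|v| + a) * ‖φ v‖ := by
  simp only [add_mul]
  refine Integrable.add ?_ (hφ.norm.const_mul a)
  simpa using hv.norm

theorem norm_boasRemainder_le (h : Represents q c f φ)
    (hv : Integrable fun v : ℝ => (v : ℂ) * φ v) (hT : 0 < T) {x : ℝ} (hx : 0 < x) :
    ‖boasRemainder c T f x‖ ≤ x ^ (-c) / (2 * Real.pi) *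
      ∫ v in {v : ℝ | Real.pi * T ≤ |v|}, (|v| + Real.pi * T) * ‖φ v‖ := by
  have hnorm (v : ℝ) :
      ‖-Complex.I * (boasMultiplier T v * φ v)‖ = |boasMultiplier T v| * ‖φ v‖ := by
    simp
  have hzero (v : ℝ) (hvT : v ∉ {v : ℝ | Real.pi * T ≤ |v|}) :
      |boasMultiplier T v| * ‖φ v‖ = 0 := by
    rw [boasMultiplier_eq_zero hT (not_le.1 hvT).le, abs_zero, zero_mul]
  have hr := represents_boasRemainder h hv T
  have hinteg : Integrable fun v => |boasMultiplier T v| * ‖φ v‖ := by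
    simpa only [hnorm] using hr.1.norm
  refine (hr.norm_le hx).trans ?_
  simp only [hnorm]
  rw [← setIntegral_eq_integral_of_forall_compl_eq_zero hzero]
  refine mul_le_mul_of_nonneg_left (setIntegral_mono hinteg.integrableOn
    (integrable_abs_add_mul_norm _ h.1 hv).integrableOn fun v => ?_) (by positivity)
  exact mul_le_mul_of_nonneg_right (abs_boasMultiplier_le hT.le v) (norm_nonneg _)

theorem lintegral_enorm_boasMultiplier_mul_le (hT : 0 < T) (φ : ℝ → ℂ) :
    ∫⁻ v, ‖(boasMultiplier T v : ℂ) * φ v‖ₑ ≤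
      2 * ∫⁻ v in {v : ℝ | Real.pi * T < |v|}, ‖(v : ℂ) * φ v‖ₑ := by
  have hmeas : MeasurableSet {v : ℝ | Real.pi * T < |v|} :=
    measurableSet_lt measurable_const measurable_norm
  rw [← lintegral_const_mul' _ _ ENNReal.ofNat_ne_top, ← lintegral_indicator hmeas]
  refine lintegral_mono fun v => ?_
  by_cases hvT : Real.pi * T < |v|
  · have hle : ‖(boasMultiplier T v : ℂ)‖ₑ ≤ 2 * ‖(v : ℂ)‖ₑ := by
      have habs : |boasMultiplier T v| ≤ 2 * |v| := by linarith [abs_boasMultiplier_le hT.le v]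
      simpa [← ofReal_norm, ENNReal.ofReal_mul] using ENNReal.ofReal_le_ofReal habs
    rw [Set.indicator_of_mem (by exact hvT), enorm_mul, enorm_mul, ← mul_assoc]
    gcongr
  · rw [boasMultiplier_eq_zero hT (not_lt.1 hvT)]
    simp

theorem normXInfty_boasRemainder_le (h : Represents q c f φ)
    (hv : Integrable fun v : ℝ => (v : ℂ) * φ v) (hT : 0 < T) :
    normXInfty c (boasRemainder c T f) ≤
      ENNReal.ofReal (1 / Real.pi) * distB2 1 c (Real.pi * T) (mellinDeriv c f) := by
  have hI (z : ℂ) : ‖-Complex.I * z‖ₑ = ‖z‖ₑ := by simp [← ofReal_norm]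
  have hdist := setLIntegral_enorm_le_distB2 (Real.pi * T) (represents_mellinDeriv h hv)
  have hconst : ENNReal.ofReal (1 / (2 * Real.pi)) * 2 = ENNReal.ofReal (1 / Real.pi) := by
    rw [← ENNReal.ofReal_ofNat 2, ← ENNReal.ofReal_mul (by positivity)]
    congr 1
    field_simp
  simp only [hI] at hdist
  calc normXInfty c (boasRemainder c T f)
      ≤ ENNReal.ofReal (1 / (2 * Real.pi)) * ∫⁻ v, ‖(boasMultiplier T v : ℂ) * φ v‖ₑ := by
        simpa only [hI] using (represents_boasRemainder h hv T).normXInfty_le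
    _ ≤ ENNReal.ofReal (1 / (2 * Real.pi)) *
          (2 * ∫⁻ v in {v : ℝ | Real.pi * T < |v|}, ‖(v : ℂ) * φ v‖ₑ) := by
        gcongr
        exact lintegral_enorm_boasMultiplier_mul_le hT φ
    _ = ENNReal.ofReal (1 / Real.pi) *
          ∫⁻ v in {v : ℝ | Real.pi * T < |v|}, ‖(v : ℂ) * φ v‖ₑ := by
        rw [← mul_assoc, hconst]
    _ ≤ ENNReal.ofReal (1 / Real.pi) * distB2 1 c (Real.pi * T) (mellinDeriv c f) := by
        gcongr

end Remainder

end MellinBoas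

theorem theorem10_general (c : ℝ) (f φ : ℝ → ℂ) (hφ : Represents 1 c f φ)
    (hv : Integrable (fun v : ℝ => (v : ℂ) * φ v)) (T : ℝ) (hT : 0 < T) :
    (∀ x : ℝ, 0 < x →
      HasMellinDeriv c f x (mellinDeriv c f x) ∧
      Summable (boasTerm c T f x) ∧
      mellinDeriv c f x =
        ((4 * T / Real.pi : ℝ) : ℂ) * (∑' k : ℤ, boasTerm c T f x k) + boasRemainder c T f x ∧
      IntegrableOn (fun v : ℝ => (boasMultiplier T v : ℂ) * φ v *
        (x : ℂ) ^ (-(c : ℂ) - Complex.I * (v : ℂ))) {v : ℝ | Real.pi * T ≤ |v|} ∧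
      boasRemainder c T f x =
        1 / (2 * (Real.pi : ℂ) * Complex.I) *
          ∫ v in {v : ℝ | Real.pi * T ≤ |v|},
            (boasMultiplier T v : ℂ) * φ v * (x : ℂ) ^ (-(c : ℂ) - Complex.I * (v : ℂ)) ∧
      IntegrableOn (fun v : ℝ => (|v| + Real.pi * T) * ‖φ v‖) {v : ℝ | Real.pi * T ≤ |v|} ∧
      ‖boasRemainder c T f x‖ ≤
        x ^ (-c) / (2 * Real.pi) *
          ∫ v in {v : ℝ | Real.pi * T ≤ |v|}, (|v| + Real.pi * T) * ‖φ v‖) ∧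
    MemG 1 c (mellinDeriv c f) ∧
    distB2 1 c (Real.pi * T) (mellinDeriv c f) < ⊤ ∧
    normXInfty c (boasRemainder c T f) ≤
      ENNReal.ofReal (1 / Real.pi) * distB2 1 c (Real.pi * T) (mellinDeriv c f) := by
  have hderiv := represents_mellinDeriv hφ hv
  refine ⟨fun x hx => ⟨tendsto_nhds_limUnder ⟨_, hφ.hasMellinDeriv hv hx⟩,
    (hφ.hasSum_boasTerm T hx).summable, (add_sub_cancel _ _).symm,
    (integrable_mul_cpow (integrable_boasMultiplier_mul T hφ.1 hv) c hx).integrableOn,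
    boasRemainder_eq_setIntegral hφ hv hT hx,
    (integrable_abs_add_mul_norm (Real.pi * T) hφ.1 hv).integrableOn,
    norm_boasRemainder_le hφ hv hT hx⟩,
    ⟨_, hderiv⟩, hderiv.distB2_lt_top _, normXInfty_boasRemainder_le hφ hv hT⟩

theorem theorem10 (c : ℝ) (f : ℝ → ℂ) (hf : MemM2 c f)
    (hv : Integrable (fun v : ℝ => (v : ℂ) * mellinTransform c f v)) (T : ℝ) (hT : 0 < T) :
    (∀ x : ℝ, 0 < x →
      HasMellinDeriv c f x (mellinDeriv c f x) ∧
      Summable (boasTerm c T f x) ∧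
      mellinDeriv c f x =
        ((4 * T / Real.pi : ℝ) : ℂ) * (∑' k : ℤ, boasTerm c T f x k) + boasRemainder c T f x ∧
      IntegrableOn (remainderIntegrand c T f x) {v : ℝ | Real.pi * T ≤ |v|} ∧
      boasRemainder c T f x =
        1 / (2 * (Real.pi : ℂ) * Complex.I) *
          ∫ v in {v : ℝ | Real.pi * T ≤ |v|}, remainderIntegrand c T f x v ∧
      IntegrableOn (fun v : ℝ => (|v| + Real.pi * T) * ‖mellinTransform c f v‖)
        {v : ℝ | Real.pi * T ≤ |v|} ∧
      ‖boasRemainder c T f x‖ ≤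
        x ^ (-c) / (2 * Real.pi) *
          ∫ v in {v : ℝ | Real.pi * T ≤ |v|},
            (|v| + Real.pi * T) * ‖mellinTransform c f v‖) ∧
    MemG 1 c (mellinDeriv c f) ∧
    distB2 1 c (Real.pi * T) (mellinDeriv c f) < ⊤ ∧
    normXInfty c (boasRemainder c T f) ≤
      ENNReal.ofReal (1 / Real.pi) * distB2 1 c (Real.pi * T) (mellinDeriv c f) :=
  theorem10_general c f _ (represents_mellinTransform hf) hv T hT
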